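/- Theorem (Burgess theorems for BSML and BSMLI). \label{theorem:negation_bsml} Fix a countably infinite set $\mathsf{Prop}$ of propositional variables. Formulas of BSMLI are generated by $$\phi ::= p \mid \bot \mid \lnot\phi \mid (\phi\land\phi) \mid (\phi\lor\phi) \mid \Diamond\phi \mid \mathrm{NE} \mid (\phi \mathbin{\backslash\!\!\backslash\!/} \phi)\qquad (p\in\mathsf{Prop}),$$ and BSML is the fragment without the inquisitive disjunction $\backslash\!\!\backslash\!/$. Write $\mathsf P(\phi)$ for the set of propositional variables occurring in $\phi$. For $\mathsf X\subseteq\mathsf{Prop}$, a Kripke model over $\mathsf X$ is $M=(W,R,V)$ with $W\neq\emptyset$, $R\subseteq W\times W$ and $V:\mathsf X\to\wp(W)$; a team on $M$ is a set $s\subseteq W$; and $R[w]=\{v\in W\mid wRv\}$. For $\mathsf P(\phi)\subseteq\mathsf X$, support $s\vDash\phi$ and anti-support $s\mathrel{=\!\!|}\phi$ by a team $s$ on $M$ are defined recursively: - $s\vDash p$ iff $w\in V(p)$ for all $w\in s$; $s\mathrel{=\!\!|}p$ iff $w\notin V(p)$ for all $w\in s$. - $s\vDash\bot$ iff $s=\emptyset$;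 $s\mathrel{=\!\!|}\bot$ always. - $s\vDash\mathrm{NE}$ iff $s\neq\emptyset$; $s\mathrel{=\!\!|}\mathrm{NE}$ iff $s=\emptyset$. - $s\vDash\lnot\phi$ iff $s\mathrel{=\!\!|}\phi$; $s\mathrel{=\!\!|}\lnot\phi$ iff $s\vDash\phi$. - $s\vDash\phi\land\psi$ iff $s\vDash\phi$ and $s\vDash\psi$; $s\mathrel{=\!\!|}\phi\land\psi$ iff $s=t\cup u$ for some $t,u$ with $t\mathrel{=\!\!|}\phi$ and $u\mathrel{=\!\!|}\psi$. - $s\vDash\phi\lor\psi$ iff $s=t\cup u$ for some $t,u$ with $t\vDash\phi$ and $u\vDash\psi$; $s\mathrel{=\!\!|}\phi\lor\psi$ iff $s\mathrel{=\!\!|}\phi$ and $s\mathrel{=\!\!|}\psi$. - $s\vDash\phi\mathbin{\backslash\!\!\backslash\!/}\psi$ iff $s\vDash\phi$ or $s\vDash\psi$; $s\mathrel{=\!\!|}\phi\mathbin{\backslash\!\!\backslash\!/}\psi$ iff $s\mathrel{=\!\!|}\phi$ and $s\mathrel{=\!\!|}\psi$. - $s\vDash\Diamond\phi$ iff for every $w\in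 s$ there is a nonempty $t\subseteq R[w]$ with $t\vDash\phi$; $s\mathrel{=\!\!|}\Diamond\phi$ iff $R[w]\mathrel{=\!\!|}\phi$ for every $w\in s$. Write $\phi\equiv\psi$ if, in every model over a set $\mathsf X\supseteq\mathsf P(\phi)\cup\mathsf P(\psi)$, exactly the same teams support $\phi$ and $\psi$. Call $\phi$ and $\psi$ ground-incompatible if, in every model over a set $\mathsf X\supseteq\mathsf P(\phi)\cup\mathsf P(\psi)$, all teams $s,t$ with $s\vDash\phi$ and $t\vDash\psi$ satisfy $s\cap t=\emptyset$. Let $L$ be BSML or BSMLI, and let $\phi,\psi\in L$. The following are equivalent: 1. $\phi$ and $\psi$ are ground-incompatible. 2. There is a formula $\theta\in L$ with $\phi\equiv\theta$ and $\psi\equiv\lnot\theta$. 3. There is a formula $\theta\in L$ with $\phi\equiv\theta$, $\psi\equiv\lnot\theta$ and $\mathsf P(\theta)=\mathsf P(\phi)\cup\mathsf P(\psi)$. -/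

import Mathlib

universe u v

namespace TeamLogic

/-- Formulas of the full language (bilateral state-based modal logic with the inquisitive
disjunction `intd`) over a set `P` of propositional variables. -/
inductive Formula (P : Type v) : Type v where
  | atom (p : P) : Formula P
  | bot : Formula P
  | neg (φ : Formula P) : Formula P
  | conj (φ ψ : Formula P) : Formula P
  | disj (φ ψ : Formula P) : Formula P
  | dia (φ : Formula P) : Formula P
  | ne : Formula P
  | intd (φ ψ : Formula P) : Formula P

/-- The set of propositional variables occurring in a formula. -/
def Formula.vars {P : Type v} : Formula P → Set P
  | .atom p => {p}
  | .bot => ∅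
  | .neg φ => φ.vars
  | .conj φ ψ => φ.vars ∪ ψ.vars
  | .disj φ ψ => φ.vars ∪ ψ.vars
  | .dia φ => φ.vars
  | .ne => ∅
  | .intd φ ψ => φ.vars ∪ ψ.vars

/-- The formula contains no occurrence of the inquisitive disjunction. -/
def Formula.IntdFree {P : Type v} : Formula P → Prop
  | .atom _ => True
  | .bot => True
  | .neg φ => φ.IntdFree
  | .conj φ ψ => φ.IntdFree ∧ ψ.IntdFree
  | .disj φ ψ => φ.IntdFree ∧ ψ.IntdFree
  | .dia φ => φ.IntdFree
  | .ne => True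
  | .intd _ _ => False

/-- The formulas of BSML. -/
def BSML (P : Type v) : Set (Formula P) := {φ | φ.IntdFree}

/-- The formulas of BSMLI: BSML extended with the inquisitive disjunction. -/
def BSMLI (P : Type v) : Set (Formula P) := Set.univ

/-- A Kripke model over a set `X` of propositional variables. -/
structure KripkeModel {P : Type v} (X : Set P) : Type (max (u + 1) v) where
  /-- the worlds -/
  W : Type u
  /-- there is at least one world -/
  nonempty : Nonempty W
  /-- the accessibility relation -/
  R : W → W → Prop
  /-- the valuation, defined on the variables in `X` -/
  V : X → Set W

namespace KripkeModel

/-- The set `R[w]` of worlds accessible from `w`. -/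
def image {P : Type v} {X : Set P} (M : KripkeModel.{u, v} X) (w : M.W) : Set M.W :=
  {v | M.R w v}

/-- The worlds at which `p` is true. For `p ∈ X` this is `V(p)`; variables outside `X` do not
matter, since formulas are only evaluated in models over sets that contain their variables. -/
def truthSet {P : Type v} {X : Set P} (M : KripkeModel.{u, v} X) (p : P) : Set M.W :=
  {w | ∃ h : p ∈ X, w ∈ M.V ⟨p, h⟩}

mutual

/-- `M.Supports φ s`: the team `s` on `M` supports `φ`. -/
def Supports {P : Type v} {X : Set P} (M : KripkeModel.{u, v} X) :
    Formula P → Set M.W → Prop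
  | .atom p, s => ∀ w ∈ s, w ∈ M.truthSet p
  | .bot, s => s = ∅
  | .ne, s => s ≠ ∅
  | .neg φ, s => M.AntiSupports φ s
  | .conj φ ψ, s => M.Supports φ s ∧ M.Supports ψ s
  | .disj φ ψ, s => ∃ t u : Set M.W, s = t ∪ u ∧ M.Supports φ t ∧ M.Supports ψ u
  | .intd φ ψ, s => M.Supports φ s ∨ M.Supports ψ s
  | .dia φ, s => ∀ w ∈ s, ∃ t : Set M.W, t ⊆ M.image w ∧ t ≠ ∅ ∧ M.Supports φ t

/-- `M.AntiSupports φ s`: the team `s` on `M` anti-supports `φ`. -/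
def AntiSupports {P : Type v} {X : Set P} (M : KripkeModel.{u, v} X) :
    Formula P → Set M.W → Prop
  | .atom p, s => ∀ w ∈ s, w ∉ M.truthSet p
  | .bot, _ => True
  | .ne, s => s = ∅
  | .neg φ, s => M.Supports φ s
  | .conj φ ψ, s => ∃ t u : Set M.W, s = t ∪ u ∧ M.AntiSupports φ t ∧ M.AntiSupports ψ u
  | .disj φ ψ, s => M.AntiSupports φ s ∧ M.AntiSupports ψ s
  | .intd φ ψ, s => M.AntiSupports φ s ∧ M.AntiSupports ψ s
  | .dia φ, s => ∀ w ∈ s, M.AntiSupports φ (M.image w)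

end

end KripkeModel

namespace Formula

/-- `φ` entails `ψ`: in every model over a set containing the variables of both formulas, every
team that supports `φ` supports `ψ`. -/
def Entails {P : Type v} (φ ψ : Formula P) : Prop :=
  ∀ X : Set P, φ.vars ∪ ψ.vars ⊆ X → ∀ (M : KripkeModel.{u, v} X) (s : Set M.W),
    M.Supports φ s → M.Supports ψ s

/-- Equivalence (mutual entailment). -/
def Equivalent {P : Type v} (φ ψ : Formula P) : Prop :=
  Entails.{u, v} φ ψ ∧ Entails.{u, v} ψ φ

/-- Ground-incompatibility: in every model over a set containing the variables of both formulas,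
any team supporting `φ` and any team supporting `ψ` are disjoint. -/
def GroundIncompatible {P : Type v} (φ ψ : Formula P) : Prop :=
  ∀ X : Set P, φ.vars ∪ ψ.vars ⊆ X → ∀ (M : KripkeModel.{u, v} X) (s t : Set M.W),
    M.Supports φ s → M.Supports ψ t → s ∩ t = ∅

end Formula

end TeamLogic

-- For 2 → 1, a team supporting `θ` and a team anti-supporting it never share a world
-- (`disjoint_of_supports_of_antiSupports`). For 1 → 3 there are two ingredients.
--
-- Separation: support of a formula of depth at most `k` depends only on the set of depth-`k` modal
-- types realised in the team, and over finitely many variables there are finitely many types. A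
-- type occurring both in a `φ`-team and in a `ψ`-team, possibly of different models, would give
-- overlapping teams in the disjoint union. So the types differ, and characteristic formulas of
-- types yield a flat BSML formula `α` that `ψ`-teams support and `φ`-teams anti-support
-- (`exists_separating`).
--
-- Gluing: `strict` keeps support but leaves the empty team as the only anti-supporter. Hence in
-- `φ.strict ∧ ¬(ψ.strict ∧ α)` every split demanded by an anti-supported conjunction has an empty
-- first part, which leaves the support of `φ` and the anti-support given by `ψ`. No variables are
-- added.

namespace TeamLogic

variable {P : Type v}

namespace Formula

theorem vars_finite (φ : Formula P) : φ.vars.Finite := by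
  induction φ <;> simp_all [vars]

/-- The modal depth of a formula. -/
def depth : Formula P → ℕ
  | .atom _ => 0
  | .bot => 0
  | .neg φ => φ.depth
  | .conj φ ψ => max φ.depth ψ.depth
  | .disj φ ψ => max φ.depth ψ.depth
  | .dia φ => φ.depth + 1
  | .ne => 0
  | .intd φ ψ => max φ.depth ψ.depth

end Formula

/-! ### Support and anti-support are incompatible -/

namespace KripkeModel

variable {X Y : Set P}

theorem disjoint_of_supports_of_antiSupports (M : KripkeModel.{u, v} X) (φ : Formula P)
    {s t : Set M.W} (hs : M.Supports φ s) (ht : M.AntiSupports φ t) : s ∩ t = ∅ := by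
  induction φ generalizing s t with
  | atom p =>
    ext w
    simp only [Set.mem_inter_iff, Set.mem_empty_iff_false, iff_false, not_and]
    exact fun h h' => ht w h' (hs w h)
  | bot => simp only [Supports] at hs; simp [hs]
  | ne => simp only [AntiSupports] at ht; simp [ht]
  | neg φ ih =>
    simp only [Supports, AntiSupports] at hs ht
    rw [Set.inter_comm]
    exact ih ht hs
  | conj φ ψ ih₁ ih₂ =>
    simp only [Supports, AntiSupports] at hs ht
    obtain ⟨t₁, t₂, rfl, h₁, h₂⟩ := ht
    rw [Set.inter_union_distrib_left, ih₁ hs.1 h₁, ih₂ hs.2 h₂, Set.union_empty]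
  | disj φ ψ ih₁ ih₂ =>
    simp only [Supports, AntiSupports] at hs ht
    obtain ⟨s₁, s₂, rfl, h₁, h₂⟩ := hs
    rw [Set.union_inter_distrib_right, ih₁ h₁ ht.1, ih₂ h₂ ht.2, Set.union_empty]
  | intd φ ψ ih₁ ih₂ =>
    simp only [Supports, AntiSupports] at hs ht
    exact hs.elim (fun h => ih₁ h ht.1) (fun h => ih₂ h ht.2)
  | dia φ ih =>
    simp only [Supports, AntiSupports] at hs ht
    refine Set.eq_empty_of_forall_notMem fun w hw => ?_
    obtain ⟨t', hsub, hne, h⟩ := hs w hw.1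
    -- The witness `t'` lies inside `R[w]`, which anti-supports the body, so `t'` would be empty.
    have := ih h (ht w hw.2)
    rw [Set.inter_eq_left.mpr hsub] at this
    exact hne this

/-- The model with the same truth sets, viewed as a model over all variables. -/
def extend (M : KripkeModel.{u, v} X) : KripkeModel.{u, v} (Set.univ : Set P) where
  W := M.W
  nonempty := M.nonempty
  R := M.R
  V p := M.truthSet p

theorem truthSet_extend (M : KripkeModel.{u, v} X) (p : P) :
    M.extend.truthSet p = M.truthSet p := by
  ext w
  exact ⟨fun ⟨_, h⟩ => h, fun h => ⟨trivial, h⟩⟩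

theorem supports_extend_and_antiSupports_extend (M : KripkeModel.{u, v} X) (φ : Formula P) :
    ∀ s : Set M.W, (M.extend.Supports φ s ↔ M.Supports φ s) ∧
      (M.extend.AntiSupports φ s ↔ M.AntiSupports φ s) := by
  induction φ with
  | atom p =>
    intro s
    simp only [Supports, AntiSupports, truthSet_extend]
    exact ⟨Iff.rfl, Iff.rfl⟩
  | bot => exact fun s => ⟨Iff.rfl, Iff.rfl⟩
  | ne => exact fun s => ⟨Iff.rfl, Iff.rfl⟩
  | neg φ ih =>
    intro s
    simp only [Supports, AntiSupports]
    exact ⟨(ih s).2, (ih s).1⟩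
  | conj φ ψ ih₁ ih₂ =>
    intro s
    simp only [Supports, AntiSupports]
    exact ⟨and_congr (ih₁ s).1 (ih₂ s).1, exists_congr fun t => exists_congr fun u =>
      and_congr_right fun _ => and_congr (ih₁ t).2 (ih₂ u).2⟩
  | disj φ ψ ih₁ ih₂ =>
    intro s
    simp only [Supports, AntiSupports]
    exact ⟨exists_congr fun t => exists_congr fun u =>
      and_congr_right fun _ => and_congr (ih₁ t).1 (ih₂ u).1, and_congr (ih₁ s).2 (ih₂ s).2⟩
  | intd φ ψ ih₁ ih₂ =>
    intro s
    simp only [Supports, AntiSupports]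
    exact ⟨or_congr (ih₁ s).1 (ih₂ s).1, and_congr (ih₁ s).2 (ih₂ s).2⟩
  | dia φ ih =>
    intro s
    simp only [Supports, AntiSupports]
    exact ⟨forall₂_congr fun w _ => exists_congr fun t =>
      and_congr_right fun _ => and_congr_right fun _ => (ih t).1,
      forall₂_congr fun w _ => (ih (M.image w)).2⟩

theorem supports_extend (M : KripkeModel.{u, v} X) (φ : Formula P) (s : Set M.W) :
    M.extend.Supports φ s ↔ M.Supports φ s :=
  (M.supports_extend_and_antiSupports_extend φ s).1

end KripkeModel

/-! ### Modal types and bounded bisimulation invariance -/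

/-- The modal types of depth `k` over the variables in `A`: the equivalence classes of pointed
models under `k`-bisimilarity. -/
def ModalType (A : Set P) : ℕ → Type v
  | 0 => Set A
  | k + 1 => Set A × Set (ModalType A k)

theorem ModalType.finite {A : Set P} (hA : A.Finite) (k : ℕ) : Finite (ModalType A k) := by
  have := hA.to_subtype
  induction k with
  | zero => exact inferInstanceAs (Finite (Set A))
  | succ k ih => exact inferInstanceAs (Finite (Set A × Set (ModalType A k)))

namespace KripkeModel

variable {X Y : Set P}

/-- The variables in `A` that are true at a world. -/
def atoms (M : KripkeModel.{u, v} X) (A : Set P) (w : M.W) : Set A := {p | w ∈ M.truthSet p}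

/-- The modal type of depth `k` of a world. -/
def modalType (M : KripkeModel.{u, v} X) (A : Set P) : (k : ℕ) → M.W → ModalType A k
  | 0 => M.atoms A
  | k + 1 => fun w => (M.atoms A w, M.modalType A k '' M.image w)

theorem mem_truthSet_iff_of_modalType_eq {M : KripkeModel.{u, v} X} {N : KripkeModel.{u, v} Y}
    {A : Set P} {k : ℕ} {w : M.W} {w' : N.W} (h : M.modalType A k w = N.modalType A k w')
    {p : P} (hp : p ∈ A) : w ∈ M.truthSet p ↔ w' ∈ N.truthSet p := by
  have h' : M.atoms A w = N.atoms A w' := by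
    cases k with
    | zero => exact h
    | succ k => exact congrArg Prod.fst h
  exact Set.ext_iff.mp h' ⟨p, hp⟩

end KripkeModel

/-- Transfers the splitting of a team to a team realising the same types: each part takes the worlds
whose type occurs in the given part. -/
theorem exists_union_of_image_union_eq {α β γ : Type*} {f : α → γ} {g : β → γ}
    {t u : Set α} {s : Set β} (h : f '' (t ∪ u) = g '' s) :
    ∃ t' u' : Set β, s = t' ∪ u' ∧ f '' t = g '' t' ∧ f '' u = g '' u' := by
  refine ⟨s ∩ g ⁻¹' (f '' t), s ∩ g ⁻¹' (f '' u), ?_, ?_, ?_⟩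
  · rw [← Set.inter_union_distrib_left, ← Set.preimage_union, ← Set.image_union, h]
    exact (Set.inter_eq_left.mpr (Set.subset_preimage_image g s)).symm
  · rw [Set.image_inter_preimage, ← h]
    exact (Set.inter_eq_right.mpr (Set.image_mono Set.subset_union_left)).symm
  · rw [Set.image_inter_preimage, ← h]
    exact (Set.inter_eq_right.mpr (Set.image_mono Set.subset_union_right)).symm

theorem exists_subset_image_eq {α β γ : Type*} {f : α → γ} {g : β → γ}
    {t r : Set α} {s : Set β} (ht : t ⊆ r) (h : f '' r = g '' s) :
    ∃ t' : Set β, t' ⊆ s ∧ f '' t = g '' t' := by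
  rw [← Set.union_eq_self_of_subset_left ht] at h
  obtain ⟨t', u', rfl, h₁, -⟩ := exists_union_of_image_union_eq h
  exact ⟨t', Set.subset_union_left, h₁⟩

theorem image_eq_empty_congr {α β γ : Type*} {f : α → γ} {g : β → γ}
    {t : Set α} {s : Set β} (h : f '' t = g '' s) : t = ∅ ↔ s = ∅ := by
  rw [← Set.image_eq_empty (f := f), h, Set.image_eq_empty]

namespace KripkeModel

variable {X Y : Set P}

/-- Any `k` above the depth is allowed, so that both sides of a binary connective can share one `k`.
-/
theorem supports_and_antiSupports_of_modalType_image_eq (A : Set P) (φ : Formula P)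
    (hφ : φ.vars ⊆ A) (k : ℕ) (hk : φ.depth ≤ k)
    (M : KripkeModel.{u, v} X) (N : KripkeModel.{u, v} Y) (s : Set M.W) (s' : Set N.W)
    (h : M.modalType A k '' s = N.modalType A k '' s') :
    (M.Supports φ s → N.Supports φ s') ∧ (M.AntiSupports φ s → N.AntiSupports φ s') := by
  induction φ generalizing k s s' with
  | atom p =>
    have key : ∀ w' ∈ s', ∃ w ∈ s, (w ∈ M.truthSet p ↔ w' ∈ N.truthSet p) := by
      intro w' hw'
      obtain ⟨w, hw, e⟩ := h.symm.subset (Set.mem_image_of_mem _ hw')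
      exact ⟨w, hw, mem_truthSet_iff_of_modalType_eq e (hφ rfl)⟩
    simp only [Supports, AntiSupports]
    refine ⟨fun H w' hw' => ?_, fun H w' hw' => ?_⟩ <;> obtain ⟨w, hw, e⟩ := key w' hw'
    · exact e.mp (H w hw)
    · exact fun hn => H w hw (e.mpr hn)
  | bot =>
    simp only [Supports, AntiSupports]
    exact ⟨(image_eq_empty_congr h).mp, id⟩
  | ne =>
    simp only [Supports, AntiSupports]
    exact ⟨mt (image_eq_empty_congr h).mpr, (image_eq_empty_congr h).mp⟩
  | neg φ ih =>
    simp only [Supports, AntiSupports]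
    exact (ih hφ k hk s s' h).symm
  | conj φ ψ ih₁ ih₂ =>
    obtain ⟨v₁, v₂⟩ := Set.union_subset_iff.mp hφ
    obtain ⟨d₁, d₂⟩ := max_le_iff.mp hk
    simp only [Supports, AntiSupports]
    refine ⟨And.imp (ih₁ v₁ k d₁ s s' h).1 (ih₂ v₂ k d₂ s s' h).1, ?_⟩
    rintro ⟨t, u, rfl, ht, hu⟩
    obtain ⟨t', u', e, et, eu⟩ := exists_union_of_image_union_eq h
    exact ⟨t', u', e, (ih₁ v₁ k d₁ t t' et).2 ht, (ih₂ v₂ k d₂ u u' eu).2 hu⟩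
  | disj φ ψ ih₁ ih₂ =>
    obtain ⟨v₁, v₂⟩ := Set.union_subset_iff.mp hφ
    obtain ⟨d₁, d₂⟩ := max_le_iff.mp hk
    simp only [Supports, AntiSupports]
    refine ⟨?_, And.imp (ih₁ v₁ k d₁ s s' h).2 (ih₂ v₂ k d₂ s s' h).2⟩
    rintro ⟨t, u, rfl, ht, hu⟩
    obtain ⟨t', u', e, et, eu⟩ := exists_union_of_image_union_eq h
    exact ⟨t', u', e, (ih₁ v₁ k d₁ t t' et).1 ht, (ih₂ v₂ k d₂ u u' eu).1 hu⟩
  | intd φ ψ ih₁ ih₂ =>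
    obtain ⟨v₁, v₂⟩ := Set.union_subset_iff.mp hφ
    obtain ⟨d₁, d₂⟩ := max_le_iff.mp hk
    simp only [Supports, AntiSupports]
    exact ⟨Or.imp (ih₁ v₁ k d₁ s s' h).1 (ih₂ v₂ k d₂ s s' h).1,
      And.imp (ih₁ v₁ k d₁ s s' h).2 (ih₂ v₂ k d₂ s s' h).2⟩
  | dia φ ih =>
    obtain ⟨k, rfl⟩ : ∃ m, k = m + 1 :=
      Nat.exists_eq_succ_of_ne_zero (Nat.ne_of_gt (Nat.lt_of_lt_of_le (Nat.succ_pos _) hk))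
    have hk' : φ.depth ≤ k := Nat.le_of_succ_le_succ hk
    have key : ∀ w' ∈ s', ∃ w ∈ s,
        M.modalType A k '' M.image w = N.modalType A k '' N.image w' := by
      intro w' hw'
      obtain ⟨w, hw, e⟩ := h.symm.subset (Set.mem_image_of_mem _ hw')
      exact ⟨w, hw, congrArg Prod.snd e⟩
    simp only [Supports, AntiSupports]
    refine ⟨fun H w' hw' => ?_, fun H w' hw' => ?_⟩ <;> obtain ⟨w, hw, e⟩ := key w' hw'
    · obtain ⟨t, hsub, hne, ht⟩ := H w hw
      obtain ⟨t', hsub', e'⟩ := exists_subset_image_eq hsub e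
      exact ⟨t', hsub', mt (image_eq_empty_congr e').mpr hne, (ih hφ k hk' t t' e').1 ht⟩
    · exact (ih hφ k hk' _ _ e).2 (H w hw)

-- Disjoint unions and ground-incompatibility

/-- The disjoint union of two models. -/
def sum (M : KripkeModel.{u, v} X) (N : KripkeModel.{u, v} Y) :
    KripkeModel.{u, v} (Set.univ : Set P) where
  W := M.W ⊕ N.W
  nonempty := M.nonempty.map Sum.inl
  R := Sum.LiftRel M.R N.R
  V p := Sum.inl '' M.truthSet p ∪ Sum.inr '' N.truthSet p

/-- The hypotheses make `f` a bounded morphism, that is, a functional bisimulation. -/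
theorem modalType_map {M : KripkeModel.{u, v} X} {N : KripkeModel.{u, v} Y} (f : M.W → N.W)
    (htruth : ∀ p w, f w ∈ N.truthSet p ↔ w ∈ M.truthSet p)
    (himage : ∀ w, N.image (f w) = f '' M.image w) (A : Set P) (k : ℕ) (w : M.W) :
    N.modalType A k (f w) = M.modalType A k w := by
  have hatoms : ∀ w, N.atoms A (f w) = M.atoms A w := fun w => Set.ext fun p => htruth p w
  induction k generalizing w with
  | zero => exact hatoms w
  | succ k ih =>
    simp only [modalType]
    rw [hatoms, himage, Set.image_image]
    exact congrArg _ (Set.image_congr fun x _ => ih x)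

/-- The left inclusion into the disjoint union. -/
def inl (M : KripkeModel.{u, v} X) (N : KripkeModel.{u, v} Y) : M.W → (M.sum N).W := Sum.inl

/-- The right inclusion into the disjoint union. -/
def inr (M : KripkeModel.{u, v} X) (N : KripkeModel.{u, v} Y) : N.W → (M.sum N).W := Sum.inr

theorem modalType_inl (M : KripkeModel.{u, v} X) (N : KripkeModel.{u, v} Y) (A : Set P)
    (k : ℕ) (w : M.W) : (M.sum N).modalType A k (M.inl N w) = M.modalType A k w := by
  refine modalType_map (M.inl N) (fun p w => ⟨?_, fun h => ⟨trivial, .inl ⟨w, h, rfl⟩⟩⟩)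
    (fun w => Set.ext fun x => ⟨?_, ?_⟩) A k w
  · rintro ⟨_, ⟨x, hx, e⟩ | ⟨x, -, e⟩⟩
    · exact Sum.inl_injective e ▸ hx
    · exact absurd e Sum.inr_ne_inl
  · rintro (h : Sum.LiftRel M.R N.R (Sum.inl w) x)
    cases h with
    | inl h => exact ⟨_, h, rfl⟩
  · rintro ⟨y, hy, e⟩
    exact e ▸ Sum.LiftRel.inl hy

theorem modalType_inr (M : KripkeModel.{u, v} X) (N : KripkeModel.{u, v} Y) (A : Set P)
    (k : ℕ) (w : N.W) : (M.sum N).modalType A k (M.inr N w) = N.modalType A k w := by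
  refine modalType_map (M.inr N) (fun p w => ⟨?_, fun h => ⟨trivial, .inr ⟨w, h, rfl⟩⟩⟩)
    (fun w => Set.ext fun x => ⟨?_, ?_⟩) A k w
  · rintro ⟨_, ⟨x, -, e⟩ | ⟨x, hx, e⟩⟩
    · exact absurd e Sum.inl_ne_inr
    · exact Sum.inr_injective e ▸ hx
  · rintro (h : Sum.LiftRel M.R N.R (Sum.inr w) x)
    cases h with
    | inr h => exact ⟨_, h, rfl⟩
  · rintro ⟨y, hy, e⟩
    exact e ▸ Sum.LiftRel.inr hy

end KripkeModel

/-- In models of ground-incompatible formulas, worlds in supporting teams have different modal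
types. -/
theorem Formula.GroundIncompatible.modalType_ne {φ ψ : Formula P}
    (h : Formula.GroundIncompatible.{u, v} φ ψ) {X Y : Set P} {M : KripkeModel.{u, v} X}
    {N : KripkeModel.{u, v} Y} {s : Set M.W} {t : Set N.W} (hs : M.Supports φ s)
    (ht : N.Supports ψ t) {w : M.W} {w' : N.W} (hw : w ∈ s) (hw' : w' ∈ t) {k : ℕ}
    (hφ : φ.depth ≤ k) (hψ : ψ.depth ≤ k) :
    M.modalType (φ.vars ∪ ψ.vars) k w ≠ N.modalType (φ.vars ∪ ψ.vars) k w' := by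
  intro e
  set A := φ.vars ∪ ψ.vars
  have h₁ : (M.sum N).Supports φ (M.inl N '' s) := by
    refine (KripkeModel.supports_and_antiSupports_of_modalType_image_eq A φ
      Set.subset_union_left k hφ M (M.sum N) s _ ?_).1 hs
    simp only [Set.image_image, KripkeModel.modalType_inl]
  -- Adding the copy of `w` realises no new type, since `w'` already has its type; yet this team now
  -- meets the copy of `s`.
  have h₂ : (M.sum N).Supports ψ (insert (M.inl N w) (M.inr N '' t)) := by
    refine (KripkeModel.supports_and_antiSupports_of_modalType_image_eq A ψ
      Set.subset_union_right k hψ N (M.sum N) t _ ?_).1 ht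
    simp only [Set.image_insert_eq, Set.image_image, KripkeModel.modalType_inl,
      KripkeModel.modalType_inr, e]
    exact (Set.insert_eq_of_mem (Set.mem_image_of_mem _ hw')).symm
  have := h Set.univ (Set.subset_univ _) (M.sum N) _ _ h₁ h₂
  exact Set.notMem_empty (M.inl N w)
    (this.subset ⟨Set.mem_image_of_mem _ hw, Set.mem_insert _ _⟩)

/-! ### Definability of modal types -/

/-- The property `D` of pointed models is defined, with flat support and anti-support, by a BSML
formula over the variables in `A`. -/
def Definable (A : Set P)
    (D : ∀ {X : Set P} (M : KripkeModel.{u, v} X), Set M.W) : Prop :=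
  ∃ α : Formula P, α.IntdFree ∧ α.vars ⊆ A ∧ ∀ {X : Set P} (M : KripkeModel.{u, v} X)
    (s : Set M.W), (M.Supports α s ↔ s ⊆ D M) ∧ (M.AntiSupports α s ↔ s ⊆ (D M)ᶜ)

theorem exists_union_subset_iff {α : Type*} {s D E : Set α} :
    (∃ t u : Set α, s = t ∪ u ∧ t ⊆ D ∧ u ⊆ E) ↔ s ⊆ D ∪ E := by
  constructor
  · rintro ⟨t, u, rfl, ht, hu⟩
    exact Set.union_subset_union ht hu
  · intro h
    refine ⟨s ∩ D, s ∩ E, ?_, Set.inter_subset_right, Set.inter_subset_right⟩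
    rw [← Set.inter_union_distrib_left, Set.inter_eq_left.mpr h]

namespace Definable

variable {A : Set P} {D E : ∀ {X : Set P} (M : KripkeModel.{u, v} X), Set M.W}

theorem empty : Definable.{u, v} A fun _ => ∅ :=
  ⟨.bot, trivial, Set.empty_subset _, fun M s => by
    simp [KripkeModel.Supports, KripkeModel.AntiSupports]⟩

theorem truthSet {p : P} (hp : p ∈ A) : Definable.{u, v} A fun M => M.truthSet p :=
  ⟨.atom p, trivial, Set.singleton_subset_iff.mpr hp, fun M s => by
    simp only [KripkeModel.Supports, KripkeModel.AntiSupports]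
    exact ⟨Iff.rfl, Iff.rfl⟩⟩

theorem compl (h : Definable.{u, v} A D) : Definable.{u, v} A fun M => (D M)ᶜ := by
  obtain ⟨α, hα, hv, H⟩ := h
  refine ⟨.neg α, hα, hv, fun M s => ?_⟩
  simp only [KripkeModel.Supports, KripkeModel.AntiSupports, compl_compl]
  exact (H M s).symm

theorem union (h : Definable.{u, v} A D) (h' : Definable.{u, v} A E) :
    Definable.{u, v} A fun M => D M ∪ E M := by
  obtain ⟨α, hα, hv, H⟩ := h
  obtain ⟨β, hβ, hv', H'⟩ := h'
  refine ⟨.disj α β, ⟨hα, hβ⟩, Set.union_subset hv hv', fun M s => ?_⟩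
  simp only [KripkeModel.Supports, KripkeModel.AntiSupports, H, H', Set.compl_union,
    Set.subset_inter_iff, and_true, exists_union_subset_iff]

theorem inter (h : Definable.{u, v} A D) (h' : Definable.{u, v} A E) :
    Definable.{u, v} A fun M => D M ∩ E M := by
  simpa only [Set.compl_union, compl_compl] using (h.compl.union h'.compl).compl

theorem dia (h : Definable.{u, v} A D) :
    Definable.{u, v} A fun M => {w | (M.image w ∩ D M).Nonempty} := by
  obtain ⟨α, hα, hv, H⟩ := h
  refine ⟨.dia α, hα, hv, fun M s => ?_⟩
  simp only [KripkeModel.Supports, KripkeModel.AntiSupports, H]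
  refine ⟨forall₂_congr fun w _ => ⟨?_, fun h => ?_⟩, forall₂_congr fun w _ => ?_⟩
  · rintro ⟨t, h₁, h₂, h₃⟩
    exact (Set.nonempty_iff_ne_empty.mpr h₂).mono (Set.subset_inter h₁ h₃)
  -- By flatness the largest candidate `R[w] ∩ D` serves as witness.
  · exact ⟨_, Set.inter_subset_left, Set.nonempty_iff_ne_empty.mp h, Set.inter_subset_right⟩
  · simp only [Set.mem_compl_iff, Set.mem_ofPred_eq, Set.not_nonempty_iff_eq_empty,
      ← Set.disjoint_iff_inter_eq_empty, Set.subset_compl_iff_disjoint_right]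

theorem biUnion {ι : Type*} {I : Set ι} (hI : I.Finite)
    {F : ι → ∀ {X : Set P} (M : KripkeModel.{u, v} X), Set M.W}
    (h : ∀ i, Definable.{u, v} A (F i)) : Definable.{u, v} A fun M => ⋃ i ∈ I, F i M := by
  induction I, hI using Set.Finite.induction_on with
  | empty => simpa using empty
  | @insert a s _ _ ih => simpa only [Set.biUnion_insert] using (h a).union ih

theorem iInter {ι : Type*} [Finite ι]
    {F : ι → ∀ {X : Set P} (M : KripkeModel.{u, v} X), Set M.W}
    (h : ∀ i, Definable.{u, v} A (F i)) : Definable.{u, v} A fun M => ⋂ i, F i M := by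
  simpa using (biUnion (Set.finite_univ (α := ι)) fun i => (h i).compl).compl

theorem iff_const (h : Definable.{u, v} A D) (q : Prop) :
    Definable.{u, v} A fun M => {w | w ∈ D M ↔ q} := by
  by_cases hq : q
  · simpa [hq] using h
  · simpa [hq, Set.compl_def] using h.compl

theorem atoms_eq (hA : A.Finite) (τ : Set A) :
    Definable.{u, v} A fun M => {w | M.atoms A w = τ} := by
  have := hA.to_subtype
  have h := iInter fun p : A => (truthSet.{u, v} p.2).iff_const (p ∈ τ)
  convert h using 3 with X M
  ext w
  simp only [Set.mem_ofPred_eq, Set.mem_iInter]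
  exact Set.ext_iff

/-- Hintikka formulas: fix the atoms and, for each of the finitely many types `σ` of depth `k`,
whether some successor has type `σ`. -/
theorem modalType_eq (hA : A.Finite) (k : ℕ) (τ : ModalType A k) :
    Definable.{u, v} A fun M => {w | M.modalType A k w = τ} := by
  induction k with
  | zero => exact atoms_eq hA τ
  | succ k ih =>
    have := ModalType.finite hA k
    have h := (atoms_eq.{u, v} hA τ.1).inter
      (iInter fun σ : ModalType A k => (ih σ).dia.iff_const (σ ∈ τ.2))
    convert h using 3 with X M
    ext w
    simp only [Set.mem_ofPred_eq, Set.mem_inter_iff, Set.mem_iInter, KripkeModel.modalType]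
    exact Prod.ext_iff.trans (and_congr_right fun _ => Set.ext_iff)

theorem modalType_mem (hA : A.Finite) (k : ℕ) (C : Set (ModalType A k)) :
    Definable.{u, v} A fun M => {w | M.modalType A k w ∈ C} := by
  have := ModalType.finite hA k
  convert biUnion (Set.toFinite C) fun τ => modalType_eq.{u, v} hA k τ using 3 with X M
  ext w
  simp

end Definable

/-- Ground-incompatible formulas are separated by a BSML formula over their variables. -/
theorem Formula.GroundIncompatible.exists_separating {φ ψ : Formula P}
    (h : Formula.GroundIncompatible.{u, v} φ ψ) :
    ∃ α : Formula P, α.IntdFree ∧ α.vars ⊆ φ.vars ∪ ψ.vars ∧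
      ∀ {X : Set P} (M : KripkeModel.{u, v} X) (s : Set M.W),
        (M.Supports ψ s → M.Supports α s) ∧ (M.Supports φ s → M.AntiSupports α s) := by
  obtain ⟨α, hα, hv, H⟩ := Definable.modalType_mem.{u, v}
    (φ.vars_finite.union ψ.vars_finite) (max φ.depth ψ.depth)
    -- All types met by `ψ`-teams, over all models at once, so that one `α` serves every model.
    {τ | ∃ (X : Set P) (M : KripkeModel.{u, v} X) (s : Set M.W), M.Supports ψ s ∧
      ∃ w ∈ s, M.modalType _ _ w = τ}
  refine ⟨α, hα, hv, fun M s => ⟨fun hs => ?_, fun hs => ?_⟩⟩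
  · exact (H M s).1.mpr fun w hw => ⟨_, M, s, hs, w, hw, rfl⟩
  · refine (H M s).2.mpr fun w hw => ?_
    rintro ⟨Y, N, t, ht, w', hw', e⟩
    exact h.modalType_ne hs ht hw hw' (le_max_left _ _) (le_max_right _ _) e.symm

/-! ### Controlling anti-support -/

namespace Formula

mutual

/-- A formula with the same supporting teams as `φ` that the empty team anti-supports. -/
def pos : Formula P → Formula P
  | .atom p => .atom p
  | .bot => .bot
  | .neg φ => φ.negPos
  | .conj φ ψ => .conj φ.pos ψ.pos
  | .disj φ ψ => .disj φ.pos ψ.pos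
  | .dia φ => .dia φ
  | .ne => .ne
  | .intd φ ψ => .intd φ.pos ψ.pos

/-- A formula supported by the teams that anti-support `φ`, and anti-supported by the empty
team. -/
def negPos : Formula P → Formula P
  | .atom p => .neg (.atom p)
  | .bot => .neg .bot
  | .neg φ => φ.pos
  | .conj φ ψ => .disj φ.negPos ψ.negPos
  | .disj φ ψ => .conj φ.negPos ψ.negPos
  | .dia φ => .neg (.dia φ)
  | .ne => .bot
  | .intd φ ψ => .conj φ.negPos ψ.negPos

end

theorem vars_pos_and_vars_negPos (φ : Formula P) :
    φ.pos.vars = φ.vars ∧ φ.negPos.vars = φ.vars := by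
  induction φ <;> simp_all [pos, negPos, vars]

theorem IntdFree.pos_and_negPos {φ : Formula P} (h : φ.IntdFree) :
    φ.pos.IntdFree ∧ φ.negPos.IntdFree := by
  induction φ <;> simp_all [pos, negPos, IntdFree]

theorem supports_pos_and_negPos {X : Set P} (M : KripkeModel.{u, v} X) (φ : Formula P) :
    (∀ s, M.Supports φ.pos s ↔ M.Supports φ s) ∧
      ∀ s, M.Supports φ.negPos s ↔ M.AntiSupports φ s := by
  induction φ <;> simp_all [pos, negPos, KripkeModel.Supports, KripkeModel.AntiSupports]

/-- The only obstruction is a negated `NE`, which the empty team does not anti-support; `negPos`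
replaces it by `⊥`, with the same support but anti-supported by every team. -/
theorem antiSupports_empty_pos_and_negPos {X : Set P} (M : KripkeModel.{u, v} X)
    (φ : Formula P) : M.AntiSupports φ.pos ∅ ∧ M.AntiSupports φ.negPos ∅ := by
  have split : ∀ α β : Formula P, M.AntiSupports α ∅ → M.AntiSupports β ∅ →
      ∃ t u : Set M.W, ∅ = t ∪ u ∧ M.AntiSupports α t ∧ M.AntiSupports β u :=
    fun _ _ hα hβ => ⟨∅, ∅, (Set.union_empty _).symm, hα, hβ⟩
  induction φ <;> simp_all [pos, negPos, KripkeModel.Supports, KripkeModel.AntiSupports]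

/-- A formula that only the empty team supports, and only the empty team anti-supports. -/
def zero : Formula P := .dia (.conj .bot (.neg (.conj .bot .ne)))

/-- A formula with the same supporting teams as `φ`, anti-supported by the empty team only. -/
def strict (φ : Formula P) : Formula P := .disj φ.pos zero

theorem vars_strict (φ : Formula P) : φ.strict.vars = φ.vars := by
  simp [strict, vars, zero, φ.vars_pos_and_vars_negPos.1]

theorem IntdFree.strict {φ : Formula P} (h : φ.IntdFree) : φ.strict.IntdFree :=
  ⟨h.pos_and_negPos.1, by simp [zero, IntdFree]⟩

variable {X : Set P} (M : KripkeModel.{u, v} X)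

theorem supports_zero (s : Set M.W) : M.Supports zero s ↔ s = ∅ := by
  constructor
  · intro h
    simp only [zero, KripkeModel.Supports] at h
    refine Set.eq_empty_of_forall_notMem fun w hw => ?_
    obtain ⟨t, -, hne, ht, -⟩ := h w hw
    exact hne ht
  · rintro rfl
    simp [zero, KripkeModel.Supports]

/-- Anti-support of the body would need part of `R[w]` to support `⊥ ∧ NE`; the outer `◇` makes the
condition vacuous for the empty team. -/
theorem antiSupports_zero (s : Set M.W) : M.AntiSupports zero s ↔ s = ∅ := by
  constructor
  · intro h
    simp only [zero, KripkeModel.Supports, KripkeModel.AntiSupports] at h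
    refine Set.eq_empty_of_forall_notMem fun w hw => ?_
    obtain ⟨t, t', -, -, ht, hne⟩ := h w hw
    exact hne ht
  · rintro rfl
    simp [zero, KripkeModel.AntiSupports]

theorem supports_strict (φ : Formula P) (s : Set M.W) :
    M.Supports φ.strict s ↔ M.Supports φ s := by
  simp [strict, KripkeModel.Supports, supports_zero, (supports_pos_and_negPos M φ).1]

theorem antiSupports_strict (φ : Formula P) (s : Set M.W) :
    M.AntiSupports φ.strict s ↔ s = ∅ := by
  simp only [strict, KripkeModel.AntiSupports, antiSupports_zero, and_iff_right_iff_imp]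
  rintro rfl
  exact (antiSupports_empty_pos_and_negPos M φ).1

-- The Burgess formula and the equivalence

/-- A formula with the supporting teams of `φ` and the anti-supporting teams of `ψ`, provided that
`α` separates `ψ` from `φ`. -/
def burgess (φ ψ α : Formula P) : Formula P := .conj φ.strict (.neg (.conj ψ.strict α))

theorem supports_burgess {φ ψ α : Formula P}
    (h : ∀ s, M.Supports φ s → M.AntiSupports α s) (s : Set M.W) :
    M.Supports (burgess φ ψ α) s ↔ M.Supports φ s := by
  simpa [burgess, KripkeModel.Supports, KripkeModel.AntiSupports, supports_strict,
    antiSupports_strict] using h s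

theorem antiSupports_burgess {φ ψ α : Formula P}
    (h : ∀ s, M.Supports ψ s → M.Supports α s) (s : Set M.W) :
    M.AntiSupports (burgess φ ψ α) s ↔ M.Supports ψ s := by
  simpa [burgess, KripkeModel.Supports, KripkeModel.AntiSupports, supports_strict,
    antiSupports_strict] using h s

theorem GroundIncompatible.of_equivalent {φ ψ θ : Formula P}
    (hφ : Equivalent.{u, v} φ θ) (hψ : Equivalent.{u, v} ψ θ.neg) :
    GroundIncompatible.{u, v} φ ψ := by
  intro X _ M s t hs ht
  -- `θ` may contain variables outside `X`, where the equivalences say nothing about `M`; hence the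
  -- passage to all variables.
  have h₁ := hφ.1 Set.univ (Set.subset_univ _) M.extend s ((M.supports_extend φ s).mpr hs)
  have h₂ := hψ.1 Set.univ (Set.subset_univ _) M.extend t ((M.supports_extend ψ t).mpr ht)
  simp only [KripkeModel.Supports] at h₂
  exact M.extend.disjoint_of_supports_of_antiSupports θ h₁ h₂

end Formula

end TeamLogic

theorem mainTheorem1 {P : Type v} [Countable P] [Infinite P]
    (L : Set (TeamLogic.Formula P)) (hL : L = TeamLogic.BSML P ∨ L = TeamLogic.BSMLI P)
    (φ ψ : TeamLogic.Formula P) (hφ : φ ∈ L) (hψ : ψ ∈ L) :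
    List.TFAE [
      TeamLogic.Formula.GroundIncompatible.{u, v} φ ψ,
      ∃ θ ∈ L, TeamLogic.Formula.Equivalent.{u, v} φ θ ∧
        TeamLogic.Formula.Equivalent.{u, v} ψ θ.neg,
      ∃ θ ∈ L, TeamLogic.Formula.Equivalent.{u, v} φ θ ∧
        TeamLogic.Formula.Equivalent.{u, v} ψ θ.neg ∧
        θ.vars = φ.vars ∪ ψ.vars] := by
  tfae_have 3 → 2 := fun ⟨θ, hθ, h₁, h₂, _⟩ => ⟨θ, hθ, h₁, h₂⟩
  tfae_have 2 → 1 := fun ⟨_, _, h₁, h₂⟩ => .of_equivalent h₁ h₂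
  tfae_have 1 → 3 := by
    intro h
    obtain ⟨α, hα, hv, H⟩ := h.exists_separating
    refine ⟨.burgess φ ψ α, ?_, ?_, ?_, ?_⟩
    · rcases hL with rfl | rfl
      · exact ⟨TeamLogic.Formula.IntdFree.strict hφ, TeamLogic.Formula.IntdFree.strict hψ, hα⟩
      · trivial
    · exact ⟨fun X _ M s => (TeamLogic.Formula.supports_burgess M (fun s => (H M s).2) s).mpr,
        fun X _ M s => (TeamLogic.Formula.supports_burgess M (fun s => (H M s).2) s).mp⟩
    · constructor
      · intro X _ M s hs
        simp only [TeamLogic.KripkeModel.Supports]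
        exact (TeamLogic.Formula.antiSupports_burgess M (fun s => (H M s).1) s).mpr hs
      · intro X _ M s hs
        simp only [TeamLogic.KripkeModel.Supports] at hs
        exact (TeamLogic.Formula.antiSupports_burgess M (fun s => (H M s).1) s).mp hs
    · simp only [TeamLogic.Formula.burgess, TeamLogic.Formula.vars,
        TeamLogic.Formula.vars_strict, ← Set.union_assoc]
      exact Set.union_eq_self_of_subset_right hv
  tfae_finish
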